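/- Let $\mathbb{F}_q$ be a finite field with $q\equiv 1\pmod 4$ elements, let $A=\mathbb{F}_q[T]$, and put $|f|=q^{\deg f}$ for nonzero $f\in A$. Let $g\ge 0$ be an integer and let $D\in\mathcal{H}_{2g+1,q}$, i.e. $D\in A$ is monic and square-free of degree $2g+1$. For monic $f\in A$ let $\chi_D(f)=\left(\frac{D}{f}\right)$ be the quadratic residue symbol: for a monic irreducible $P$, $\left(\frac{D}{P}\right)$ is $0$ if $P\mid D$, $1$ if $P\nmid D$ and $D$ is a square modulo $P$, and $-1$ otherwise, and $\left(\frac{D}{f}\right)$ is extended to all monic $f$ by complete multiplicativity. Let $a_n=\sum_{f\text{ monic},\,\deg f=n}\chi_D(f)$ and $$L(s,\chi_D)=\sum_{n\ge 0}a_n q^{-ns}.$$ Then: 1. for $\operatorname{Re}(s)>1$ the Dirichlet series $\sum_{f\text{ monic}}\chi_D(f)|f|^{-s}$ converges absolutely to $L(s,\chi_D)$; 2. $a_n=0$ for all $n>2g$, so $L(s,\chi_D)$ is a polynomial in $u=q^{-s}$ of degree at most $2g$, defined for all $s\in\mathbb{C}$; 3. for every $s\in\mathbb{C}$, $$L(s,\chi_D)=\sum_{\substack{f\text{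 monic}\\ \deg f\le g}}\frac{\chi_D(f)}{|f|^{s}}+\left(q^{1-2s}\right)^{g}\sum_{\substack{f\text{ monic}\\ \deg f\le g-1}}\frac{\chi_D(f)}{|f|^{1-s}},$$ where the second sum is empty if $g=0$. -/

import Mathlib

open Polynomial

noncomputable section

namespace QuadL

variable (F : Type*) [Field F] [Fintype F]

/-- For each degree bound `n` there are only finitely many monic polynomials of degree `< n`. -/
theorem finite_monic_natDegree_lt (n : ℕ) :
    {f : F[X] | f.Monic ∧ f.natDegree < n}.Finite := by
  apply Set.Finite.of_injOn (f := fun (f : F[X]) (i : Fin n) => f.coeff i) (t := Set.univ)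
  · intro f _
    exact Set.mem_univ _
  · intro f hf f' hf' h
    ext i
    by_cases hi : i < n
    · exact congrFun h ⟨i, hi⟩
    · rw [coeff_eq_zero_of_natDegree_lt (lt_of_lt_of_le hf.2 (not_lt.mp hi)),
        coeff_eq_zero_of_natDegree_lt (lt_of_lt_of_le hf'.2 (not_lt.mp hi))]
  · exact Set.finite_univ

/-- The finite set of monic polynomials `f ∈ 𝔽_q[T]` with `deg f < n`. -/
def monicDegLT (n : ℕ) : Finset F[X] := (finite_monic_natDegree_lt F n).toFinset

/-- The finite set of monic polynomials `f ∈ 𝔽_q[T]` with `deg f ≤ n`. -/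
def monicDegLE (n : ℕ) : Finset F[X] := monicDegLT F (n + 1)

open Classical in
/-- The finite set of monic polynomials `f ∈ 𝔽_q[T]` with `deg f = n`. -/
def monicDegEq (n : ℕ) : Finset F[X] := (monicDegLE F n).filter fun f => f.natDegree = n

theorem mem_monicDegLT {n : ℕ} {f : F[X]} :
    f ∈ monicDegLT F n ↔ f.Monic ∧ f.natDegree < n := by
  simp [monicDegLT]

theorem mem_monicDegLE {n : ℕ} {f : F[X]} :
    f ∈ monicDegLE F n ↔ f.Monic ∧ f.natDegree ≤ n := by
  simp [monicDegLE, mem_monicDegLT]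

theorem mem_monicDegEq {n : ℕ} {f : F[X]} :
    f ∈ monicDegEq F n ↔ f.Monic ∧ f.natDegree = n := by
  simp only [monicDegEq, Finset.mem_filter, mem_monicDegLE]
  constructor
  · rintro ⟨⟨h, _⟩, h'⟩
    exact ⟨h, h'⟩
  · rintro ⟨h, h'⟩
    exact ⟨⟨h, h'.le⟩, h'⟩

/-- The family `𝓗_{d,q}` of monic square-free polynomials of degree `d` over `𝔽_q`. -/
def monicSquarefree (d : ℕ) : Set F[X] :=
  {D | D.Monic ∧ D.natDegree = d ∧ Squarefree D}

variable {F}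

/-- The norm `|f| = q ^ deg f` of a (nonzero) polynomial over `𝔽_q`. -/
def polyNorm (f : F[X]) : ℕ := Fintype.card F ^ f.natDegree

open Classical in
/-- The quadratic residue symbol `(D / P)` for an irreducible polynomial `P` :
`0` if `P ∣ D`, `1` if `D` is a nonzero square modulo `P`, and `-1` otherwise. -/
def residueSymbol (D P : F[X]) : ℤ :=
  if P ∣ D then 0 else if ∃ r : F[X], P ∣ D - r ^ 2 then 1 else -1

open Classical in
/-- The quadratic character `χ_D(f) = (D / f)`, where for monic `f = P₁ ⋯ P_k` (`P_i` monic
irreducible, with multiplicity) the symbol `(D / f)` is the product of the `(D / P_i)`. -/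
def chi (D f : F[X]) : ℤ :=
  ((UniqueFactorizationMonoid.normalizedFactors f).map (residueSymbol D)).prod

/-- The coefficient `a_n` of `u ^ n` in the `L`-function of `χ_D` : the sum of `χ_D(f)` over all
monic `f` of degree `n`. -/
def lCoeff (D : F[X]) (n : ℕ) : ℤ := ∑ f ∈ monicDegEq F n, chi D f

/-- The `L`-function `L(s, χ_D) = ∑_n a_n u ^ n`, `u = q ^ (-s)`, i.e. the Dirichlet series
`∑_f χ_D(f) |f| ^ (-s)` over monic `f`, summed by degree. When only finitely many `a_n` are
nonzero this is a polynomial in `q ^ (-s)`, defined for every complex `s`. -/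
def LFunction (D : F[X]) (s : ℂ) : ℂ :=
  ∑' n : ℕ, (lCoeff D n : ℂ) * ((Fintype.card F : ℂ) ^ (-s)) ^ n

end QuadL

end

/-! Everything follows from the vanishing of `a_n` for `n > 2g` and the symmetry `q^g a_n = q^n
a_{2g-n}` (`lCoeff_functional_equation`): the approximate functional equation then folds the terms
of degree above `g` onto those of degree below `g`.

Reciprocity: `χ_D(f)` is the quadratic character of `Res(f, D)`. The resultant is symmetric up to a
power of `-1`, a square since `q ≡ 1 mod 4`, so `χ_D(f)` equals `χ(f) = ∏ (f / P_i)` over the primes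
`P_i` of `D`, a function of `f` mod `D` (`chi_prod_eq_prod_quadraticChar`).

Poisson summation: under the pairing of `a` and `v` by the residue of `av/D` at infinity, the
annihilator of degree `< n` is degree `< deg D - n`. Expanding `χ` through its Gauss sum `G` turns
`a_n G` into `q^n` times a sum over degree `≤ 2g - n` in which the additive character `ψ` sees only
the leading coefficient. As `deg D` is odd, `χ` restricts to the quadratic character on constants,
and the sum becomes `τ a_{2g-n}`, with `τ` the Gauss sum of `F`. For `n > 2g` only `a = 0` survives,
where `χ` vanishes.

Finally `G = q^g τ`, because `G` is also the sum of `ψ` over the quadratic form `res(x²/D)`, for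
which degree `< g` is totally isotropic with orthogonal complement degree `≤ g`. The value of `τ` is
never needed, only `τ ≠ 0`. -/

namespace QuadL

/-! ### Norms from residue fields as resultants -/

section Reciprocity

variable {F : Type*} [Field F]

/-- The norm of the class of `Q` in the field `F[X] / (P)` is the resultant of `P` and `Q`. -/
theorem norm_adjoinRoot_mk [PerfectField F] {P : F[X]} [hP : Fact (Irreducible P)] (hm : P.Monic)
    (Q : F[X]) : Algebra.norm F (AdjoinRoot.mk P Q) = resultant P Q := by
  classical
  let E := AlgebraicClosure F
  have : FiniteDimensional F (AdjoinRoot P) := (AdjoinRoot.powerBasis hm.ne_zero).finite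
  have : Algebra.IsAlgebraic F (AdjoinRoot P) := Algebra.IsAlgebraic.of_finite F _
  -- Separability makes the embeddings correspond to the roots of `P` counted with multiplicity, as
  -- in the product formula for the resultant.
  have hnd : (P.aroots E).Nodup :=
    nodup_roots (PerfectField.separable_of_irreducible hP.out).map
  apply (algebraMap F E).injective
  rw [Algebra.norm_eq_prod_embeddings]
  have h1 : ∀ σ : AdjoinRoot P →ₐ[F] E, σ (AdjoinRoot.mk P Q) =
      aeval ((AdjoinRoot.equiv E F P hm.ne_zero σ : E)) Q := by
    intro σ
    have : ((AdjoinRoot.equiv E F P hm.ne_zero σ : E)) = σ (AdjoinRoot.root P) := rfl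
    rw [this, ← AdjoinRoot.aeval_eq, aeval_algHom_apply]
  simp_rw [h1]
  rw [Fintype.prod_equiv (AdjoinRoot.equiv E F P hm.ne_zero) _
    (fun x => aeval (x : E) Q) (fun _ => rfl)]
  rw [← resultant_map_map]
  have h2 := resultant_eq_prod_eval (P.map (algebraMap F E)) (Q.map (algebraMap F E)) Q.natDegree
    natDegree_map_le (IsAlgClosed.splits _)
  rw [natDegree_map] at h2
  rw [h2, (hm.map _).leadingCoeff, one_pow, one_mul]
  rw [← Finset.prod_subtype (P.aroots E).toFinset (fun x => by simp)
    (fun x => aeval x Q), Finset.prod_eq_multiset_prod, Multiset.toFinset_val,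
    hnd.dedup]
  simp [aroots_def, eval_map_algebraMap]

end Reciprocity

/-! ### Quadratic reciprocity through resultants -/

section Finite

variable {F : Type*} [Field F] [Fintype F]

noncomputable instance fintypeAdjoinRoot (P : F[X]) [hP : Fact (Irreducible P)] :
    Fintype (AdjoinRoot P) :=
  have := (AdjoinRoot.powerBasis hP.out.ne_zero).finite
  have := Module.finite_of_finite F (M := AdjoinRoot P)
  Fintype.ofFinite _

/-- The quadratic character of a finite extension is the quadratic character of the norm. -/
theorem quadraticChar_norm {K : Type*} [Field K] [Fintype K] [DecidableEq K] [DecidableEq F]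
    [Algebra F K] (hF : ringChar F ≠ 2) (x : K) :
    quadraticChar F (Algebra.norm F x) = quadraticChar K x := by
  have hK : ringChar K ≠ 2 := by rwa [← Algebra.ringChar_eq F K]
  have h1 : (((quadraticChar F (Algebra.norm F x) : ℤ) : F) : F) =
      (Algebra.norm F x) ^ (Fintype.card F / 2) := quadraticChar_eq_pow_of_char_ne_two' hF _
  have h2 := quadraticChar_eq_pow_of_char_ne_two' hK x
  -- Euler's criterion on both sides, with `N(x) = x^((Q-1)/(q-1))`, where `Q = |K|`. Equality in
  -- `K` suffices because `1 ≠ -1` there.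
  have h3 : ((quadraticChar F (Algebra.norm F x) : ℤ) : K) = (quadraticChar K x : ℤ) := by
    rw [h2, ← map_intCast (algebraMap F K), h1, map_pow, FiniteField.algebraMap_norm_eq_pow,
      ← pow_mul]
    congr 1
    rw [← Fintype.card_eq_nat_card, ← Fintype.card_eq_nat_card]
    have hq : Fintype.card F % 2 = 1 := FiniteField.odd_card_of_char_ne_two hF
    have hQ : Fintype.card K % 2 = 1 := FiniteField.odd_card_of_char_ne_two hK
    have hd : Fintype.card F - 1 ∣ Fintype.card K - 1 := by
      rw [Module.card_eq_pow_finrank (K := F) (V := K)]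
      exact Nat.sub_one_dvd_pow_sub_one _ _
    obtain ⟨k, hk⟩ := hd
    have h1q : 1 < Fintype.card F := Fintype.one_lt_card
    rw [hk, Nat.mul_div_cancel_left _ (by omega)]
    obtain ⟨m, hm⟩ : ∃ m, Fintype.card F = 2 * m + 1 := ⟨Fintype.card F / 2, by omega⟩
    have hm2 : Fintype.card F / 2 = m := by omega
    rw [hm2]
    have : Fintype.card K = 2 * (k * m) + 1 := by
      have h1Q : 1 < Fintype.card K := Fintype.one_lt_card
      have h5 : Fintype.card K = (Fintype.card F - 1) * k + 1 := by omega
      rw [h5, hm]; simp; ring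
    omega
  by_cases hx : x = 0
  · simp [hx, Algebra.norm_zero]
  have hn : Algebra.norm F x ≠ 0 := Algebra.norm_ne_zero_iff.mpr hx
  have hne : (-1 : K) ≠ 1 := Ring.neg_one_ne_one_of_char_ne_two hK
  rcases quadraticChar_dichotomy hn with h | h <;>
    rcases quadraticChar_dichotomy hx with h' | h' <;> rw [h, h'] at h3 ⊢ <;> simp at h3
  · exact absurd h3.symm hne
  · exact absurd h3 hne

theorem residueSymbol_eq_quadraticChar (D P : F[X]) [hP : Fact (Irreducible P)] :
    residueSymbol D P = quadraticChar (AdjoinRoot P) (AdjoinRoot.mk P D) := by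
  rw [residueSymbol, quadraticChar_apply, quadraticCharFun]
  have h : (∃ r : F[X], P ∣ D - r ^ 2) ↔ IsSquare (AdjoinRoot.mk P D) := by
    rw [isSquare_iff_exists_sq, AdjoinRoot.mk_surjective.exists]
    simp_rw [← map_pow, AdjoinRoot.mk_eq_mk]
  simp only [AdjoinRoot.mk_eq_zero, h]
  congr!
  exact AdjoinRoot.mk_eq_zero.symm

theorem residueSymbol_eq_resultant [DecidableEq F] (hF : ringChar F ≠ 2) (D P : F[X])
    (hP : Irreducible P) (hm : P.Monic) :
    residueSymbol D P = quadraticChar F (resultant P D) := by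
  have := Fact.mk hP
  rw [residueSymbol_eq_quadraticChar, ← norm_adjoinRoot_mk hm, quadraticChar_norm hF]

omit [Fintype F] in
theorem resultant_multiset_prod_left (s : Multiset F[X]) (D : F[X]) (hs : ∀ P ∈ s, P.Monic) :
    resultant s.prod D = (s.map fun P => resultant P D).prod := by
  induction s using Multiset.induction with
  | empty => simp
  | cons P s ih =>
    have h1 : P.Monic := hs P (by simp)
    have h2 : ∀ Q ∈ s, Q.Monic := fun Q hQ => hs Q (by simp [hQ])
    have h3 : s.prod.Monic := by
      have := monic_multiset_prod_of_monic s id (by simpa using h2)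
      simpa using this
    rw [Multiset.prod_cons, h1.natDegree_mul h3, resultant_mul_left _ _ _ _ le_rfl, ih h2,
      Multiset.map_cons, Multiset.prod_cons]

omit [Fintype F] in
open Classical in
theorem monic_of_mem_normalizedFactors {f P : F[X]}
    (hP : P ∈ UniqueFactorizationMonoid.normalizedFactors f) : P.Monic := by
  have h := UniqueFactorizationMonoid.normalize_normalized_factor P hP
  rw [← h]
  exact monic_normalize (UniqueFactorizationMonoid.irreducible_of_normalized_factor P hP).ne_zero

omit [Fintype F] in
open Classical in
theorem prod_normalizedFactors_of_monic {f : F[X]} (hf : f.Monic) :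
    (UniqueFactorizationMonoid.normalizedFactors f).prod = f := by
  refine eq_of_monic_of_associated ?_ hf
    (UniqueFactorizationMonoid.prod_normalizedFactors hf.ne_zero)
  have := monic_multiset_prod_of_monic (UniqueFactorizationMonoid.normalizedFactors f) id
    (fun P hP => monic_of_mem_normalizedFactors hP)
  simpa using this

-- Both sides are multiplicative in `f`, which reduces the claim to the irreducible factors.
open Classical in
theorem chi_eq_resultant (hF : ringChar F ≠ 2) (D : F[X]) {f : F[X]}
    (hf : f.Monic) : chi D f = quadraticChar F (resultant f D) := by
  conv_rhs => rw [← prod_normalizedFactors_of_monic hf]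
  rw [resultant_multiset_prod_left _ _ (fun P hP => monic_of_mem_normalizedFactors hP),
    map_multiset_prod, chi, Multiset.map_map]
  congr 1
  refine Multiset.map_congr rfl fun P hP => ?_
  exact residueSymbol_eq_resultant hF D P
    (UniqueFactorizationMonoid.irreducible_of_normalized_factor P hP)
    (monic_of_mem_normalizedFactors hP)

/-- Quadratic reciprocity over a finite field with `q ≡ 1 mod 4` elements. -/
theorem chi_prod_eq_prod_quadraticChar (hq : Fintype.card F % 4 = 1) {ι : Type*} [Fintype ι]
    (P : ι → F[X]) [∀ i, Fact (Irreducible (P i))] (hP : ∀ i, (P i).Monic) {f : F[X]}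
    (hf : f.Monic) :
    chi (∏ i, P i) f = ∏ i, quadraticChar (AdjoinRoot (P i)) (AdjoinRoot.mk (P i) f) := by
  classical
  have hF : ringChar F ≠ 2 := by
    intro h
    have := FiniteField.even_card_iff_char_two.mp h
    omega
  have h1 : quadraticChar F (-1) = 1 :=
    (quadraticChar_one_iff_isSquare (by simp)).mpr
      (FiniteField.isSquare_neg_one_iff.mpr (by omega))
  rw [chi_eq_resultant hF _ hf, resultant_comm, map_mul, map_pow, h1, one_pow, one_mul,
    resultant_prod_left _ _ _ _ (by simp [fun i => (hP i).leadingCoeff]) le_rfl, map_prod]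
  refine Finset.prod_congr rfl fun i _ => ?_
  rw [← norm_adjoinRoot_mk (hP i), quadraticChar_norm hF]

end Finite

/-! ### Quadratic Gauss sums over a product of finite fields -/

section ProductOfFields

theorem addChar_map_sum {A ι : Type*} [AddCommMonoid A] (ψ : AddChar A ℂ) (s : Finset ι)
    (f : ι → A) : ψ (∑ i ∈ s, f i) = ∏ i ∈ s, ψ (f i) := by
  classical
  induction s using Finset.induction with
  | empty => simp
  | insert a s ha ih => rw [Finset.sum_insert ha, Finset.prod_insert ha, AddChar.map_add_eq_mul, ih]

/-- An element `a` has `1 + quadraticChar K a` square roots, and the constant `1` contributes the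
sum of a nontrivial character, which is zero. -/
theorem sum_addChar_sq {K : Type*} [Field K] [Fintype K] [DecidableEq K] (hK : ringChar K ≠ 2)
    (ψ : AddChar K ℂ) (hψ : ψ ≠ 1) :
    ∑ x, ψ (x ^ 2) = ∑ a, (quadraticChar K a : ℂ) * ψ a := by
  have h1 : ∀ a : K, ∑ x with x ^ 2 = a, ψ (x ^ 2) = (quadraticChar K a : ℂ) * ψ a + ψ a := by
    intro a
    rw [Finset.sum_congr rfl (g := fun _ => ψ a) (fun x hx => by
      rw [(Finset.mem_filter.mp hx).2])]
    have h := quadraticChar_card_sqrts hK a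
    rw [Finset.sum_const, nsmul_eq_mul, ← add_one_mul]
    congr 1
    have h2 : (Finset.univ.filter fun x : K => x ^ 2 = a) = {x : K | x ^ 2 = a}.toFinset := by
      ext; simp
    rw [h2]
    exact_mod_cast h
  rw [← Finset.sum_fiberwise Finset.univ (fun x : K => x ^ 2) (fun x => ψ (x ^ 2))]
  simp_rw [h1, Finset.sum_add_distrib, AddChar.sum_eq_zero_of_ne_one hψ, add_zero]

variable {ι : Type*} [Fintype ι] {K : ι → Type*} [∀ i, Field (K i)]
  [∀ i, Fintype (K i)] [∀ i, DecidableEq (K i)]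

/-- The product of the quadratic characters of the factors of a product of finite fields. -/
def piQuadraticChar (a : ∀ i, K i) : ℤ := ∏ i, quadraticChar (K i) (a i)

theorem piQuadraticChar_mul (a b : ∀ i, K i) :
    piQuadraticChar (a * b) = piQuadraticChar a * piQuadraticChar b := by
  simp_rw [piQuadraticChar, Pi.mul_apply, map_mul, Finset.prod_mul_distrib]

/-- For a unit `b`, substitute `a * b` for `a`. If `b i = 0`, scaling coordinate `i` of `a` by a
nonresidue fixes `a * b` but flips the sign of the character, so the sum is its own negative. -/
theorem sum_piQuadraticChar_mul_addChar_mul [DecidableEq ι] (hK : ∀ i, ringChar (K i) ≠ 2)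
    (ψ : AddChar (∀ i, K i) ℂ) (b : ∀ i, K i) :
    ∑ a, (piQuadraticChar a : ℂ) * ψ (a * b) =
      piQuadraticChar b * ∑ a, (piQuadraticChar a : ℂ) * ψ a := by
  by_cases hb : ∃ i, b i = 0
  · obtain ⟨i, hi⟩ := hb
    have hb0 : piQuadraticChar b = 0 :=
      Finset.prod_eq_zero (Finset.mem_univ i) (by simp [hi])
    obtain ⟨c, hc⟩ := quadraticChar_exists_neg_one' (hK i)
    let u : (∀ i, K i)ˣ := MulEquiv.piUnits.symm (Function.update 1 i c)
    have hu : ∀ j, (u : ∀ i, K i) j = ((Function.update 1 i c : ∀ i, (K i)ˣ) j : K j) := fun _ => rfl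
    have hub : (u : ∀ i, K i) * b = b := by
      ext j
      rw [Pi.mul_apply, hu]
      by_cases hj : j = i
      · subst hj; simp [hi]
      · simp [hj]
    have hχu : piQuadraticChar (u : ∀ i, K i) = -1 := by
      rw [piQuadraticChar, Finset.prod_eq_single i]
      · rw [hu]; simpa using hc
      · intro j _ hj
        rw [hu]; simp [hj]
      · simp
    have h := Fintype.sum_equiv (Units.mulRight u)
      (fun a => (piQuadraticChar (a * (u : ∀ i, K i)) : ℂ) * ψ (a * (u : ∀ i, K i) * b))
      (fun a => (piQuadraticChar a : ℂ) * ψ (a * b)) (fun a => rfl)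
    simp_rw [mul_assoc, hub, piQuadraticChar_mul, hχu] at h
    simp only [mul_neg, mul_one, neg_mul, Finset.sum_neg_distrib, Int.cast_neg] at h
    rw [hb0, Int.cast_zero, zero_mul]
    exact neg_eq_self.mp h
  · push Not at hb
    let u : (∀ i, K i)ˣ := MulEquiv.piUnits.symm fun i => Units.mk0 (b i) (hb i)
    have hu : (u : ∀ i, K i) = b := rfl
    have hsq : piQuadraticChar b * piQuadraticChar b = 1 := by
      rw [piQuadraticChar, ← Finset.prod_mul_distrib]
      exact Finset.prod_eq_one fun i _ => by
        rw [← sq, quadraticChar_sq_one (hb i)]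
    rw [Finset.mul_sum]
    refine Fintype.sum_equiv (Units.mulRight u) _ _ fun a => ?_
    simp only [Units.mulRight_apply, hu]
    rw [piQuadraticChar_mul, ← mul_assoc, ← Int.cast_mul, mul_comm (piQuadraticChar a), ← mul_assoc,
      hsq, one_mul]

theorem sum_addChar_sq_pi [DecidableEq ι] (hK : ∀ i, ringChar (K i) ≠ 2)
    (ψ : AddChar (∀ i, K i) ℂ) (hψ : ∀ i, ∃ x : K i, ψ (Pi.single i x) ≠ 1) :
    ∑ x, ψ (x ^ 2) = ∑ a, (piQuadraticChar a : ℂ) * ψ a := by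
  let ψ' : ∀ i, AddChar (K i) ℂ := fun i => ψ.compAddMonoidHom (AddMonoidHom.single K i)
  have h1 : ∀ x, ψ x = ∏ i, ψ' i (x i) := by
    intro x
    conv_lhs => rw [← Finset.univ_sum_single x]
    rw [addChar_map_sum]
    rfl
  have h2 : ∀ i, ψ' i ≠ 1 := by
    intro i
    obtain ⟨x, hx⟩ := hψ i
    exact AddChar.ne_one_iff.mpr ⟨x, hx⟩
  have h3 : ∏ i, ∑ x, ψ' i (x ^ 2) = ∏ i, ∑ a, (quadraticChar (K i) a : ℂ) * ψ' i a :=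
    Finset.prod_congr rfl fun i _ => sum_addChar_sq (hK i) _ (h2 i)
  rw [Finset.prod_univ_sum, Finset.prod_univ_sum, Fintype.piFinset_univ] at h3
  simp_rw [h1, piQuadraticChar, Int.cast_prod, ← Finset.prod_mul_distrib]
  exact h3

end ProductOfFields

/-! ### The residue pairing and Chinese remaindering -/

section Transfer

variable {F : Type*} [Field F] [Fintype F]

noncomputable instance fintypeDegreeLT (n : ℕ) : Fintype (degreeLT F n) :=
  have := Finite.of_equiv _ (degreeLTEquiv F n).toEquiv.symm
  Fintype.ofFinite _

omit [Fintype F] in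
theorem finrank_degreeLT (n : ℕ) : Module.finrank F (degreeLT F n) = n := by
  rw [(degreeLTEquiv F n).finrank_eq]; simp

theorem card_degreeLT (n : ℕ) : Fintype.card (degreeLT F n) = Fintype.card F ^ n := by
  rw [Module.card_eq_pow_finrank (K := F), finrank_degreeLT]

/-- Up to the factor `D`, the residue at infinity of `f / D`: the coefficient of `X ^ (deg D - 1)`
of `f` modulo `D`. -/
noncomputable def residueCoeff (D : F[X]) : F[X] →ₗ[F] F :=
  (lcoeff F (D.natDegree - 1)).comp (Polynomial.modByMonicHom D)

omit [Fintype F] in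
theorem residueCoeff_of_mem {D : F[X]} (hD : D.Monic) {f : F[X]}
    (hf : f ∈ degreeLT F D.natDegree) : residueCoeff D f = f.coeff (D.natDegree - 1) := by
  have : f %ₘ D = f := (modByMonic_eq_self_iff hD).mpr (by
    rwa [degree_eq_natDegree hD.ne_zero, ← mem_degreeLT])
  simp [residueCoeff, Polynomial.modByMonicHom, this]

omit [Fintype F] in
theorem modByMonic_mem_degreeLT {D : F[X]} (hD : D.Monic) (f : F[X]) :
    f %ₘ D ∈ degreeLT F D.natDegree := by
  rw [mem_degreeLT, ← degree_eq_natDegree hD.ne_zero]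
  exact degree_modByMonic_lt f hD

omit [Fintype F] in
theorem residueCoeff_modByMonic {D : F[X]} (hD : D.Monic) (f : F[X]) :
    residueCoeff D (f %ₘ D) = residueCoeff D f := by
  have := (modByMonic_eq_self_iff hD).mpr (degree_modByMonic_lt f hD)
  simp [residueCoeff, Polynomial.modByMonicHom, this]

omit [Fintype F] in
-- Nondegeneracy of the residue pairing: a monomial shifts the leading coefficient of `p` to
-- position `deg D - 1`.
theorem exists_residueCoeff_mul_ne_zero {D : F[X]} (hD : D.Monic) {p : F[X]} (hp : p ≠ 0)
    {n : ℕ} (hpD : p ∈ degreeLT F D.natDegree) (hn : p ∉ degreeLT F (D.natDegree - n)) :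
    ∃ v ∈ degreeLT F n, residueCoeff D (p * v) ≠ 0 := by
  rw [mem_degreeLT, degree_eq_natDegree hp, Nat.cast_lt] at hpD hn
  refine ⟨X ^ (D.natDegree - 1 - p.natDegree), ?_, ?_⟩
  · rw [mem_degreeLT, degree_X_pow, Nat.cast_lt]; omega
  · rw [residueCoeff_of_mem hD]
    · have : D.natDegree - 1 = p.natDegree + (D.natDegree - 1 - p.natDegree) := by omega
      conv_lhs => rw [this]
      rw [add_comm p.natDegree, add_tsub_cancel_right, add_comm, coeff_mul_X_pow]
      simpa using hp
    · rw [mem_degreeLT, degree_eq_natDegree (by simp [hp]), natDegree_mul_X_pow _ hp, Nat.cast_lt]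
      omega

variable {ι : Type*} [Fintype ι] (P : ι → F[X]) [∀ i, Fact (Irreducible (P i))]

/-- The Chinese remainder isomorphism on representatives of degree less than `deg (∏ i, P i)`. -/
noncomputable def crtEquiv (hP : Pairwise fun i j => IsCoprime (P i) (P j)) :
    degreeLT F (∏ i, P i).natDegree ≃ₗ[F] ∀ i, AdjoinRoot (P i) := by
  have hne : ∀ i, P i ≠ 0 := fun i => (Fact.out : Irreducible (P i)).ne_zero
  have (i : ι) : Module.Finite F (AdjoinRoot (P i)) := (AdjoinRoot.powerBasis (hne i)).finite
  refine LinearEquiv.ofInjectiveOfFinrankEq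
    ((LinearMap.pi fun i => (AdjoinRoot.mkₐ (P i)).toLinearMap).comp (Submodule.subtype _)) ?_ ?_
  · rw [injective_iff_map_eq_zero]
    intro a ha
    have h1 : ∀ i, P i ∣ (a : F[X]) := fun i => AdjoinRoot.mk_eq_zero.mp (congrFun ha i)
    have h2 := Fintype.prod_dvd_of_coprime hP h1
    have h3 : (a : F[X]).degree < (∏ i, P i).degree := by
      rw [degree_eq_natDegree (Finset.prod_ne_zero_iff.mpr fun i _ => hne i)]
      exact mem_degreeLT.mp a.2
    exact Subtype.ext (eq_zero_of_dvd_of_degree_lt h2 h3)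
  · rw [finrank_degreeLT, Module.finrank_pi_fintype, natDegree_prod _ _ fun i _ => hne i]
    exact Finset.sum_congr rfl fun i _ => by
      rw [(AdjoinRoot.powerBasis (hne i)).finrank, AdjoinRoot.powerBasis_dim]

theorem crtEquiv_apply (hP : Pairwise fun i j => IsCoprime (P i) (P j))
    (a : degreeLT F (∏ i, P i).natDegree) (i : ι) :
    crtEquiv P hP a i = AdjoinRoot.mk (P i) a := rfl

end Transfer

/-! ### The character modulo `D` and its Gauss sum -/

section PolyChar

variable {F : Type*} [Field F] [Fintype F] {ι : Type*} [Fintype ι]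
  (P : ι → F[X]) [∀ i, Fact (Irreducible (P i))]

/-- The product over `i` of the quadratic residue symbols `(f / P i)`. -/
noncomputable def polyChar (f : F[X]) : ℤ :=
  piQuadraticChar fun i => AdjoinRoot.mk (P i) f

theorem polyChar_mul (f g : F[X]) : polyChar P (f * g) = polyChar P f * polyChar P g := by
  rw [polyChar, polyChar, polyChar, ← piQuadraticChar_mul]
  congr 1

theorem polyChar_zero [Nonempty ι] : polyChar P 0 = 0 :=
  Finset.prod_eq_zero (Finset.mem_univ (Classical.arbitrary ι)) (by simp only [map_zero, MulChar.map_zero])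

omit [Fintype F] [Fintype ι] in
theorem ringChar_adjoinRoot_ne_two (hF : ringChar F ≠ 2) (i : ι) :
    ringChar (AdjoinRoot (P i)) ≠ 2 := by
  rwa [← Algebra.ringChar_eq F (AdjoinRoot (P i))]

/-- The norm to `F` of the constant `c` in the residue field of `P i` is `c ^ deg (P i)`. -/
theorem polyChar_C [DecidableEq F] (hF : ringChar F ≠ 2) (c : F) :
    polyChar P (C c) = quadraticChar F c ^ (∏ i, P i).natDegree := by
  have hne : ∀ i, P i ≠ 0 := fun i => (Fact.out : Irreducible (P i)).ne_zero
  rw [polyChar, piQuadraticChar, natDegree_prod _ _ fun i _ => hne i, ← Finset.prod_pow_eq_pow_sum]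
  refine Finset.prod_congr rfl fun i _ => ?_
  have h : AdjoinRoot.mk (P i) (C c) = algebraMap F (AdjoinRoot (P i)) c := rfl
  rw [← quadraticChar_norm (F := F) hF, h, Algebra.norm_algebraMap, map_pow,
    (AdjoinRoot.powerBasis (hne i)).finrank, AdjoinRoot.powerBasis_dim]

variable {P} (hP : Pairwise fun i j => IsCoprime (P i) (P j)) (hm : ∀ i, (P i).Monic)

include hm in
theorem crtEquiv_symm_mk (f : F[X]) :
    ((crtEquiv P hP).symm (fun i => AdjoinRoot.mk (P i) f) : F[X]) = f %ₘ ∏ i, P i := by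
  have hD : (∏ i, P i).Monic := monic_prod_of_monic _ _ fun i _ => hm i
  have h : (crtEquiv P hP).symm (fun i => AdjoinRoot.mk (P i) f) =
      ⟨f %ₘ ∏ i, P i, modByMonic_mem_degreeLT hD f⟩ := by
    rw [LinearEquiv.symm_apply_eq]
    funext i
    rw [crtEquiv_apply]
    refine AdjoinRoot.mk_eq_mk.mpr ((Finset.dvd_prod_of_mem P (Finset.mem_univ i)).trans ?_)
    exact ⟨f /ₘ ∏ i, P i, by rw [sub_eq_iff_eq_add', modByMonic_add_div]⟩
  rw [h]

/-- The additive character of the product of the residue fields induced by `ψ` and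
`residueCoeff`. -/
noncomputable def residueAddChar (ψ : AddChar F ℂ) : AddChar (∀ i, AdjoinRoot (P i)) ℂ :=
  ψ.compAddMonoidHom ((residueCoeff (∏ i, P i)).comp
    ((Submodule.subtype _).comp (crtEquiv P hP).symm.toLinearMap)).toAddMonoidHom

include hm in
theorem residueAddChar_mk (ψ : AddChar F ℂ) (f : F[X]) :
    residueAddChar hP ψ (fun i => AdjoinRoot.mk (P i) f) = ψ (residueCoeff (∏ i, P i) f) := by
  have hD : (∏ i, P i).Monic := monic_prod_of_monic _ _ fun i _ => hm i
  rw [← residueCoeff_modByMonic hD, ← crtEquiv_symm_mk hP hm]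
  rfl

include hP hm

theorem sum_polyChar_mul_addChar (hF : ringChar F ≠ 2) (ψ : AddChar F ℂ) (f : F[X]) :
    ∑ a : degreeLT F (∏ i, P i).natDegree,
      (polyChar P a : ℂ) * ψ (residueCoeff (∏ i, P i) (a * f)) =
    polyChar P f * ∑ a : degreeLT F (∏ i, P i).natDegree,
      (polyChar P a : ℂ) * ψ (residueCoeff (∏ i, P i) a) := by
  classical
  have h := sum_piQuadraticChar_mul_addChar_mul (ringChar_adjoinRoot_ne_two P hF)
    (residueAddChar hP ψ) (fun i => AdjoinRoot.mk (P i) f)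
  rw [← Equiv.sum_comp (crtEquiv P hP).toEquiv, ← Equiv.sum_comp (crtEquiv P hP).toEquiv] at h
  simp_rw [← residueAddChar_mk hP hm]
  exact h

theorem sum_addChar_residueCoeff_sq (hF : ringChar F ≠ 2) (ψ : AddChar F ℂ) (hψ : ψ.IsPrimitive) :
    ∑ a : degreeLT F (∏ i, P i).natDegree, ψ (residueCoeff (∏ i, P i) (a ^ 2 : F[X])) =
    ∑ a : degreeLT F (∏ i, P i).natDegree,
      (polyChar P a : ℂ) * ψ (residueCoeff (∏ i, P i) a) := by
  classical
  have hD : (∏ i, P i).Monic := monic_prod_of_monic _ _ fun i _ => hm i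
  have h := sum_addChar_sq_pi (ringChar_adjoinRoot_ne_two P hF) (residueAddChar hP ψ) (fun i => by
    -- `p` represents the idempotent of the `i`-th factor, so multiples of `p` only have an `i`-th
    -- coordinate. Nondegeneracy then makes `ψ` nontrivial on that factor.
    let p := (crtEquiv P hP).symm (Pi.single i 1)
    have hp : p ≠ 0 := by simp [p]
    have hE : (fun j => AdjoinRoot.mk (P j) p) = Pi.single i 1 :=
      (crtEquiv P hP).apply_symm_apply _
    have hp' : (p : F[X]) ≠ 0 := by simpa using hp
    obtain ⟨v, -, hv⟩ := exists_residueCoeff_mul_ne_zero hD (n := (∏ i, P i).natDegree) hp' p.2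
      (by rw [Nat.sub_self, mem_degreeLT]; simpa using hp)
    obtain ⟨c, hc⟩ := AddChar.ne_one_iff.mp (hψ hv)
    refine ⟨AdjoinRoot.mk (P i) (v * C c), ?_⟩
    have h1 : Pi.single i (AdjoinRoot.mk (P i) (v * C c)) =
        fun j => AdjoinRoot.mk (P j) (p * v * C c) := by
      funext j
      have h2 : AdjoinRoot.mk (P j) p = (Pi.single i 1 : ∀ i, AdjoinRoot (P i)) j := congrFun hE j
      rw [mul_assoc, map_mul _ (p : F[X]), h2]
      by_cases hj : j = i
      · subst hj; simp
      · simp [hj]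
    rw [h1, residueAddChar_mk hP hm, mul_comm, ← smul_eq_C_mul, map_smul, smul_eq_mul, mul_comm]
    exact hc)
  rw [← Equiv.sum_comp (crtEquiv P hP).toEquiv, ← Equiv.sum_comp (crtEquiv P hP).toEquiv] at h
  simp_rw [← residueAddChar_mk hP hm]
  exact h

end PolyChar

/-! ### Poisson summation and evaluation of the Gauss sum -/

section Poisson

variable {F : Type*} [Field F] [Fintype F]

theorem sum_degreeLT_ite {M : Type*} [AddCommMonoid M] {m n : ℕ} (h : m ≤ n) (f : F[X] → M)
    [∀ a : degreeLT F n, Decidable ((a : F[X]) ∈ degreeLT F m)] :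
    ∑ a : degreeLT F n, (if (a : F[X]) ∈ degreeLT F m then f a else 0) =
      ∑ a : degreeLT F m, f a := by
  rw [← Finset.sum_filter]
  symm
  refine Finset.sum_nbij (fun a => ⟨a.1, degreeLT_mono h a.2⟩) ?_ ?_ ?_ ?_
  · intro a _
    exact Finset.mem_filter.mpr ⟨Finset.mem_univ _, a.2⟩
  · intro a _ b _ hab
    exact Subtype.ext (congrArg (fun x : degreeLT F n => (x : F[X])) hab)
  · intro a ha
    exact ⟨⟨a.1, (Finset.mem_filter.mp ha).2⟩, Finset.mem_coe.mpr (Finset.mem_univ _),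
      Subtype.ext rfl⟩
  · intro a _
    rfl

theorem sum_degreeLT_succ {M : Type*} [AddCommMonoid M] (m : ℕ) (f : F[X] → M) :
    ∑ a : degreeLT F (m + 1), f a = ∑ c : F, ∑ v : degreeLT F m, f (C c * X ^ m + (v : F[X])) := by
  rw [← Fintype.sum_prod_type' (f := fun (c : F) (v : degreeLT F m) => f (C c * X ^ m + (v : F[X])))]
  symm
  have hmem : ∀ x : F × degreeLT F m, C x.1 * X ^ m + (x.2 : F[X]) ∈ degreeLT F (m + 1) :=
    fun x => add_mem (mem_degreeLT.mpr ((degree_C_mul_X_pow_le m x.1).trans_lt (by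
      exact_mod_cast Nat.lt_succ_self m))) (degreeLT_mono (Nat.le_succ m) x.2.2)
  have hcoeff : ∀ x : F × degreeLT F m, (C x.1 * X ^ m + (x.2 : F[X])).coeff m = x.1 := fun x => by
    rw [coeff_add, coeff_C_mul, coeff_X_pow_self, mul_one,
      coeff_eq_zero_of_degree_lt (mem_degreeLT.mp x.2.2), add_zero]
  refine Fintype.sum_bijective (fun x => (⟨_, hmem x⟩ : degreeLT F (m + 1))) ?_ _ _ fun _ => rfl
  rw [Fintype.bijective_iff_injective_and_card]
  refine ⟨fun x y hxy => ?_, ?_⟩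
  · have h : C x.1 * X ^ m + (x.2 : F[X]) = C y.1 * X ^ m + (y.2 : F[X]) := congrArg Subtype.val hxy
    have h1 : x.1 = y.1 := by rw [← hcoeff x, h, hcoeff]
    rw [h1] at h
    exact Prod.ext h1 (Subtype.ext (add_left_cancel h))
  · rw [Fintype.card_prod, card_degreeLT, card_degreeLT, pow_succ']

-- Character orthogonality: `v ↦ ψ(res(av/D))` is trivial on degree `< n` exactly when `a` has
-- degree `< deg D - n`.
open Classical in
theorem sum_addChar_residueCoeff_mul {D : F[X]} (hD : D.Monic) {ψ : AddChar F ℂ}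
    (hψ : ψ.IsPrimitive) (n : ℕ) {a : F[X]} (ha : a ∈ degreeLT F D.natDegree) :
    ∑ v : degreeLT F n, ψ (residueCoeff D (a * v)) =
      if a ∈ degreeLT F (D.natDegree - n) then (Fintype.card F : ℂ) ^ n else 0 := by
  split_ifs with h
  · rw [Finset.sum_congr rfl (g := fun _ => (1 : ℂ)), Finset.sum_const, Finset.card_univ,
      card_degreeLT]
    · simp
    · intro v _
      by_cases hav : a * v = 0
      · simp [hav]
      have ha0 : a ≠ 0 := left_ne_zero_of_mul hav
      have hv0 : (v : F[X]) ≠ 0 := right_ne_zero_of_mul hav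
      have hv := v.2
      rw [mem_degreeLT, degree_eq_natDegree hv0, Nat.cast_lt] at hv
      rw [mem_degreeLT, degree_eq_natDegree ha0, Nat.cast_lt] at h
      rw [residueCoeff_of_mem hD, coeff_eq_zero_of_natDegree_lt, AddChar.map_zero_eq_one]
      · rw [natDegree_mul ha0 hv0]; omega
      · rw [mem_degreeLT, degree_eq_natDegree hav, natDegree_mul ha0 hv0, Nat.cast_lt]; omega
  · have ha0 : a ≠ 0 := fun h0 => h (h0 ▸ zero_mem _)
    obtain ⟨v, hv, hne⟩ := exists_residueCoeff_mul_ne_zero hD ha0 ha h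
    obtain ⟨c, hc⟩ := AddChar.ne_one_iff.mp (hψ hne)
    let ψ' : AddChar (degreeLT F n) ℂ := ψ.compAddMonoidHom ((residueCoeff D).comp
      ((LinearMap.mulLeft F a).comp (Submodule.subtype _))).toAddMonoidHom
    refine AddChar.sum_eq_zero_of_ne_one (ψ := ψ') (AddChar.ne_one_iff.mpr ⟨c • ⟨v, hv⟩, ?_⟩)
    have : ψ' (c • ⟨v, hv⟩) = ψ (residueCoeff D (a * v) * c) := by
      rw [mul_comm, ← smul_eq_mul, ← map_smul, ← mul_smul_comm]
      rfl
    rw [this]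
    exact hc

/-- The Gauss sum of the quadratic form `x ↦ residueCoeff D (x ^ 2)`, for which the polynomials of
degree less than `g` form a totally isotropic subspace. -/
theorem sum_addChar_residueCoeff_sq_eq (hF : ringChar F ≠ 2) {D : F[X]} (hD : D.Monic) {g : ℕ}
    (hg : D.natDegree = 2 * g + 1) {ψ : AddChar F ℂ} (hψ : ψ.IsPrimitive) :
    ∑ x : degreeLT F D.natDegree, ψ (residueCoeff D ((x : F[X]) ^ 2)) =
      (Fintype.card F : ℂ) ^ g * ∑ c : F, ψ (c ^ 2) := by
  classical
  have h2 : (2 : F) ≠ 0 := Ring.two_ne_zero hF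
  have hq : (Fintype.card F : ℂ) ^ g ≠ 0 := pow_ne_zero _ (Nat.cast_ne_zero.mpr Fintype.card_ne_zero)
  have hz : ∀ z : degreeLT F g, residueCoeff D ((z : F[X]) ^ 2) = 0 := by
    intro z
    have hzm := z.2
    by_cases hz0 : (z : F[X]) = 0
    · simp [hz0]
    rw [mem_degreeLT, degree_eq_natDegree hz0, Nat.cast_lt] at hzm
    rw [residueCoeff_of_mem hD, coeff_eq_zero_of_natDegree_lt]
    · rw [natDegree_pow]; omega
    · rw [mem_degreeLT, degree_eq_natDegree (pow_ne_zero 2 hz0), natDegree_pow, Nat.cast_lt]; omega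
  -- Translate by the isotropic vector `z`: `(x + z)² = x² + 2xz + z²`, and the last term has
  -- residue zero.
  have hshift : ∀ z : degreeLT F g,
      ∑ x : degreeLT F D.natDegree, ψ (residueCoeff D ((x : F[X]) ^ 2)) =
      ∑ x : degreeLT F D.natDegree,
        ψ (residueCoeff D ((x : F[X]) ^ 2)) * ψ (residueCoeff D (((2 : F) • (x : F[X])) * z)) := by
    intro z
    rw [← Equiv.sum_comp (Equiv.addRight
      (⟨z, degreeLT_mono (by omega) z.2⟩ : degreeLT F D.natDegree))]
    refine Finset.sum_congr rfl fun x _ => ?_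
    rw [← AddChar.map_add_eq_mul, ← map_add]
    have : ((Equiv.addRight (⟨z, degreeLT_mono (by omega) z.2⟩ : degreeLT F D.natDegree) x :
        degreeLT F D.natDegree) : F[X]) ^ 2 =
        ((x : F[X]) ^ 2 + ((2 : F) • (x : F[X])) * z) + (z : F[X]) ^ 2 := by
      rw [Equiv.coe_addRight, Submodule.coe_add, ofNat_smul_eq_nsmul F 2 (x : F[X])]
      simp only [nsmul_eq_mul]
      push_cast
      ring
    rw [this, map_add, hz, add_zero]
  -- Summing over all `z` kills every `x` outside the orthogonal complement, degree `< g + 1`.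
  have h3 : (Fintype.card F : ℂ) ^ g *
      ∑ x : degreeLT F D.natDegree, ψ (residueCoeff D ((x : F[X]) ^ 2)) =
      (Fintype.card F : ℂ) ^ g *
        ∑ x : degreeLT F (g + 1), ψ (residueCoeff D ((x : F[X]) ^ 2)) := by
    have h4 := Finset.sum_congr (s₁ := (Finset.univ : Finset (degreeLT F g))) rfl
      fun z _ => hshift z
    rw [Finset.sum_const, Finset.card_univ, card_degreeLT, nsmul_eq_mul, Nat.cast_pow,
      Finset.sum_comm] at h4
    rw [h4, ← sum_degreeLT_ite (show g + 1 ≤ D.natDegree by omega)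
      (fun x => ψ (residueCoeff D (x ^ 2))), Finset.mul_sum]
    refine Finset.sum_congr rfl fun x _ => ?_
    rw [← Finset.mul_sum, sum_addChar_residueCoeff_mul hD hψ g (Submodule.smul_mem _ _ x.2),
      Submodule.smul_mem_iff _ h2, show D.natDegree - g = g + 1 by omega]
    split_ifs <;> ring
  rw [mul_left_cancel₀ hq h3, sum_degreeLT_succ g (fun x => ψ (residueCoeff D (x ^ 2))),
    Finset.mul_sum]
  refine Finset.sum_congr rfl fun c _ => ?_
  -- The coefficient of `X ^ (2g)` in `(c X^g + v)²` is `c²`, whichever of the `q^g` choices `v` is.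
  rw [Finset.sum_congr rfl (g := fun _ => ψ (c ^ 2)), Finset.sum_const, Finset.card_univ,
    card_degreeLT, nsmul_eq_mul, Nat.cast_pow]
  intro v _
  have hdeg : (C c * X ^ g + (v : F[X])).natDegree ≤ g := by
    refine natDegree_le_of_degree_le ((degree_add_le _ _).trans (max_le
      (degree_C_mul_X_pow_le g c) (mem_degreeLT.mp v.2).le))
  rw [residueCoeff_of_mem hD, show D.natDegree - 1 = 2 * g by omega,
    coeff_pow_of_natDegree_le hdeg, coeff_add, coeff_C_mul, coeff_X_pow_self, mul_one,
    coeff_eq_zero_of_degree_lt (mem_degreeLT.mp v.2), add_zero]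
  rw [mem_degreeLT, hg]
  refine (degree_le_of_natDegree_le (n := 2 * g) (natDegree_pow_le_of_le 2 hdeg)).trans_lt ?_
  exact_mod_cast Nat.lt_succ_self _

/-- The sum of `χ` over the monic polynomials of degree `n`. -/
noncomputable def monicSum (χ : F[X] → ℤ) (n : ℕ) : ℤ := ∑ v : degreeLT F n, χ (X ^ n + (v : F[X]))

/-- For `c ≠ 0`, rescale `v` by `c`. For `c = 0`, scaling by a nonresidue shows that the sum equals
its negative. -/
theorem sum_degreeLT_C_mul_X_pow_add [DecidableEq F] (hF : ringChar F ≠ 2) {χ : F[X] → ℤ}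
    (hχ : ∀ c f, χ (C c * f) = quadraticChar F c * χ f) (m : ℕ) (c : F) :
    ∑ v : degreeLT F m, χ (C c * X ^ m + (v : F[X])) = quadraticChar F c * monicSum χ m := by
  by_cases hc : c = 0
  · rw [hc, MulChar.map_zero, zero_mul]
    simp only [map_zero, zero_mul, zero_add]
    obtain ⟨b, hb⟩ := quadraticChar_exists_neg_one' hF
    have h := Equiv.sum_comp (LinearEquiv.smulOfUnit b : degreeLT F m ≃ₗ[F] _).toEquiv
      (fun v : degreeLT F m => χ v)
    have h1 : ∀ v : degreeLT F m,
        χ ((LinearEquiv.smulOfUnit b : degreeLT F m ≃ₗ[F] _).toEquiv v : degreeLT F m) = - χ v := by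
      intro v
      have : (((LinearEquiv.smulOfUnit b : degreeLT F m ≃ₗ[F] _).toEquiv v : degreeLT F m) : F[X]) =
        C (b : F) * v := smul_eq_C_mul _
      rw [this, hχ, hb, neg_one_mul]
    simp_rw [h1, Finset.sum_neg_distrib] at h
    omega
  · rw [monicSum, Finset.mul_sum]
    have h := Equiv.sum_comp (LinearEquiv.smulOfUnit (Units.mk0 c hc) :
      degreeLT F m ≃ₗ[F] _).toEquiv (fun v : degreeLT F m => χ (C c * X ^ m + (v : F[X])))
    rw [← h]
    refine Finset.sum_congr rfl fun v _ => ?_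
    rw [← hχ, mul_add]
    congr 2
    exact smul_eq_C_mul _

section

variable {D : F[X]} (hD : D.Monic) {ψ : AddChar F ℂ} (hψ : ψ.IsPrimitive) {χ : F[X] → ℤ} {G : ℂ}
  (hG : ∀ f, ∑ a : degreeLT F D.natDegree, (χ a : ℂ) * ψ (residueCoeff D (a * f)) = χ f * G)

include hD hψ hG

/-- Poisson summation over the monic polynomials of degree `n`. -/
theorem monicSum_mul_eq (n : ℕ) :
    monicSum χ n * G = (Fintype.card F : ℂ) ^ n *
      ∑ a : degreeLT F (D.natDegree - n), (χ a : ℂ) * ψ (residueCoeff D ((a : F[X]) * X ^ n)) := by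
  classical
  rw [← sum_degreeLT_ite (Nat.sub_le D.natDegree n)
    (fun a : F[X] => (χ a : ℂ) * ψ (residueCoeff D ((a : F[X]) * X ^ n))), monicSum, Int.cast_sum, Finset.sum_mul]
  simp_rw [← hG]
  rw [Finset.sum_comm, Finset.mul_sum]
  refine Finset.sum_congr rfl fun a _ => ?_
  simp_rw [mul_add, map_add, AddChar.map_add_eq_mul, ← mul_assoc]
  rw [← Finset.mul_sum, sum_addChar_residueCoeff_mul hD hψ n a.2]
  split_ifs <;> ring

theorem monicSum_eq_zero (h0 : χ 0 = 0) (hG0 : G ≠ 0) {n : ℕ} (hn : D.natDegree ≤ n) :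
    monicSum χ n = 0 := by
  have h := monicSum_mul_eq hD hψ hG n
  rw [Finset.sum_eq_zero, mul_zero] at h
  · exact_mod_cast (mul_eq_zero.mp h).resolve_right hG0
  · intro a _
    have ha := mem_degreeLT.mp a.2
    rw [Nat.cast_eq_zero.mpr (Nat.sub_eq_zero_of_le hn), Nat.WithBot.lt_zero_iff,
      degree_eq_bot] at ha
    rw [ha, h0, Int.cast_zero, zero_mul]

theorem monicSum_functional_equation [DecidableEq F] (hF : ringChar F ≠ 2)
    (hχ : ∀ c f, χ (C c * f) = quadraticChar F c * χ f) {g : ℕ} (hg : D.natDegree = 2 * g + 1)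
    (hGe : G = (Fintype.card F : ℂ) ^ g * ∑ c : F, (quadraticChar F c : ℂ) * ψ c) (hG0 : G ≠ 0)
    {n : ℕ} (hn : n ≤ 2 * g) :
    (Fintype.card F : ℤ) ^ g * monicSum χ n =
      (Fintype.card F : ℤ) ^ n * monicSum χ (2 * g - n) := by
  have h := monicSum_mul_eq hD hψ hG n
  -- With `a = c X^(2g-n) + v`, the product `a X^n` has residue coefficient `c`, so the sum over `c`
  -- separates from the one over `v`.
  have h1 : ∑ a : degreeLT F (D.natDegree - n), (χ a : ℂ) * ψ (residueCoeff D ((a : F[X]) * X ^ n)) =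
      (∑ c : F, (quadraticChar F c : ℂ) * ψ c) * monicSum χ (2 * g - n) := by
    rw [show D.natDegree - n = (2 * g - n) + 1 by omega,
      sum_degreeLT_succ (2 * g - n) (fun a : F[X] => (χ a : ℂ) * ψ (residueCoeff D ((a : F[X]) * X ^ n))),
      Finset.sum_mul]
    refine Finset.sum_congr rfl fun c _ => ?_
    rw [mul_right_comm, ← Int.cast_mul, ← sum_degreeLT_C_mul_X_pow_add hF hχ, Int.cast_sum,
      Finset.sum_mul]
    refine Finset.sum_congr rfl fun v _ => ?_
    congr 2
    have hdeg : (C c * X ^ (2 * g - n) + (v : F[X])).natDegree ≤ 2 * g - n :=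
      natDegree_le_of_degree_le ((degree_add_le _ _).trans (max_le
        (degree_C_mul_X_pow_le _ c) (mem_degreeLT.mp v.2).le))
    rw [residueCoeff_of_mem hD, show D.natDegree - 1 = (2 * g - n) + n by omega, coeff_mul_X_pow,
      coeff_add, coeff_C_mul, coeff_X_pow_self, mul_one,
      coeff_eq_zero_of_degree_lt (mem_degreeLT.mp v.2), add_zero]
    rw [mem_degreeLT, hg]
    refine (degree_le_of_natDegree_le (n := 2 * g)
      ((natDegree_mul_le_of_le hdeg (natDegree_X_pow_le n)).trans (by omega))).trans_lt ?_
    exact_mod_cast Nat.lt_succ_self _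
  rw [h1] at h
  have h2 : ((Fintype.card F : ℂ) ^ g * monicSum χ n) * G =
      ((Fintype.card F : ℂ) ^ n * monicSum χ (2 * g - n)) * G := by
    rw [mul_assoc, h, hGe]
    ring
  exact_mod_cast mul_right_cancel₀ hG0 h2

end

end Poisson

/-! ### Symmetry of the coefficients of the `L`-function -/

section Coefficients

variable {F : Type*} [Field F] [Fintype F]

theorem sum_monicDegEq {M : Type*} [AddCommMonoid M] (n : ℕ) (h : F[X] → M) :
    ∑ f ∈ monicDegEq F n, h f = ∑ v : degreeLT F n, h (X ^ n + (v : F[X])) := by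
  symm
  refine Finset.sum_nbij (fun v => X ^ n + (v : F[X])) ?_ ?_ ?_ (fun _ _ => rfl)
  · intro v _
    have hv := mem_degreeLT.mp v.2
    have hm : (X ^ n + (v : F[X])).Monic := monic_X_pow_add hv
    refine (mem_monicDegEq F).mpr ⟨hm, ?_⟩
    rw [natDegree_add_eq_left_of_degree_lt (by rwa [degree_X_pow]), natDegree_X_pow]
  · intro v _ w _ hvw
    exact Subtype.ext (add_left_cancel hvw)
  · intro f hf
    obtain ⟨hm, hn⟩ := (mem_monicDegEq F).mp (Finset.mem_coe.mp hf)
    refine ⟨⟨f - X ^ n, ?_⟩, Finset.mem_coe.mpr (Finset.mem_univ _), by simp⟩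
    have hd : f.degree = n := by rw [degree_eq_natDegree hm.ne_zero, hn]
    rw [mem_degreeLT, ← hd]
    exact degree_sub_lt_left (by rw [hd, degree_X_pow]) hm.ne_zero (by simp [hm.leadingCoeff])

theorem card_monicDegEq (n : ℕ) : (monicDegEq F n).card = Fintype.card F ^ n := by
  rw [Finset.card_eq_sum_ones, sum_monicDegEq, ← Finset.card_eq_sum_ones, Finset.card_univ,
    card_degreeLT]

theorem ringChar_ne_two_of_card_mod_four (hq : Fintype.card F % 4 = 1) : ringChar F ≠ 2 := by
  intro h
  have := FiniteField.even_card_iff_char_two.mp h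
  omega

/-- The coefficients of the `L`-function vanish in degree larger than `2 * g`, and satisfy
`q ^ g * a_n = q ^ n * a_{2 * g - n}`. -/
theorem lCoeff_functional_equation (hq : Fintype.card F % 4 = 1) {g : ℕ} {D : F[X]}
    (hD : D ∈ monicSquarefree F (2 * g + 1)) :
    (∀ n, 2 * g < n → lCoeff D n = 0) ∧
    ∀ n ≤ 2 * g, (Fintype.card F : ℤ) ^ g * lCoeff D n =
      (Fintype.card F : ℤ) ^ n * lCoeff D (2 * g - n) := by
  classical
  obtain ⟨hm, hdeg, hsq⟩ := hD
  have hF := ringChar_ne_two_of_card_mod_four hq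
  let s := UniqueFactorizationMonoid.normalizedFactors D
  let P : {Q // Q ∈ s.toFinset} → F[X] := fun i => i.1
  have hirr : ∀ i, Irreducible (P i) := fun i =>
    UniqueFactorizationMonoid.irreducible_of_normalized_factor _ (Multiset.mem_toFinset.mp i.2)
  have hPm : ∀ i, (P i).Monic := fun i => by
    have h := UniqueFactorizationMonoid.normalize_normalized_factor _ (Multiset.mem_toFinset.mp i.2)
    change i.1.Monic
    rw [← h]
    exact monic_normalize (hirr i).ne_zero
  have hfact : ∀ i, Fact (Irreducible (P i)) := fun i => ⟨hirr i⟩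
  have hprod : ∏ i, P i = D := by
    have hPprod : (∏ i, P i).Monic := monic_prod_of_monic _ _ fun i _ => hPm i
    refine eq_of_monic_of_associated hPprod hm ?_
    have h1 : ∏ i, P i = s.prod := by
      rw [Finset.prod_coe_sort s.toFinset (fun Q => Q), Finset.prod_eq_multiset_prod,
        Multiset.map_id', Multiset.toFinset_val, Multiset.dedup_eq_self.mpr
          ((UniqueFactorizationMonoid.squarefree_iff_nodup_normalizedFactors hm.ne_zero).mp hsq)]
    rw [h1]
    exact UniqueFactorizationMonoid.prod_normalizedFactors hm.ne_zero
  have hcop : Pairwise fun i j => IsCoprime (P i) (P j) := by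
    intro i j hij
    refine ((hirr i).coprime_iff_not_dvd).mpr fun h => hij (Subtype.ext ?_)
    exact eq_of_monic_of_associated (hPm i) (hPm j) ((hirr i).associated_of_dvd (hirr j) h)
  -- Needed for `χ(0) = 0`: over an empty set of primes the product would be `1`.
  have hne : Nonempty {Q // Q ∈ s.toFinset} := by
    by_contra hne
    rw [not_nonempty_iff] at hne
    rw [Finset.univ_eq_empty, Finset.prod_empty] at hprod
    rw [← hprod, natDegree_one] at hdeg
    omega
  have hχ : ∀ c f, polyChar P (C c * f) = quadraticChar F c * polyChar P f := by
    intro c f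
    rw [polyChar_mul, polyChar_C P hF, hprod, hdeg]
    -- The odd power `2g + 1` of a value in `{0, 1, -1}` is that value.
    rcases quadraticChar_isQuadratic F c with h | h | h <;> rw [h] <;> simp [pow_succ, pow_mul]
  have hcoeff : ∀ n, lCoeff D n = monicSum (polyChar P) n := by
    intro n
    rw [monicSum, ← sum_monicDegEq n (polyChar P), lCoeff]
    refine Finset.sum_congr rfl fun f hf => ?_
    rw [← hprod, chi_prod_eq_prod_quadraticChar hq P hPm ((mem_monicDegEq F).mp hf).1, polyChar,
      piQuadraticChar]
  have hψ := AddChar.FiniteField.primitiveChar_to_Complex_isPrimitive F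
  set ψ := AddChar.FiniteField.primitiveChar_to_Complex F
  have hψ1 : ψ ≠ 1 := by
    have := hψ one_ne_zero
    rwa [AddChar.mulShift_one] at this
  have hG := sum_polyChar_mul_addChar hcop hPm hF ψ
  have hGe := sum_addChar_residueCoeff_sq hcop hPm hF ψ hψ
  rw [hprod] at hG hGe
  set G := ∑ a : degreeLT F D.natDegree, (polyChar P a : ℂ) * ψ (residueCoeff D a)
  -- Comparing the two evaluations of the quadratic sum gives `q^g τ = G`.
  rw [sum_addChar_residueCoeff_sq_eq hF hm hdeg hψ, sum_addChar_sq hF ψ hψ1] at hGe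
  have hgauss : ∑ c : F, (quadraticChar F c : ℂ) * ψ c ≠ 0 :=
    gaussSum_ne_zero_of_nontrivial (Nat.cast_ne_zero.mpr Fintype.card_ne_zero)
      (χ := (quadraticChar F).ringHomComp (Int.castRingHom ℂ))
      ((MulChar.ringHomComp_ne_one_iff (RingHom.injective_int _)).mpr (quadraticChar_ne_one hF)) hψ
  have hG0 : G ≠ 0 := by
    rw [← hGe]
    exact mul_ne_zero (pow_ne_zero _ (Nat.cast_ne_zero.mpr Fintype.card_ne_zero)) hgauss
  simp_rw [hcoeff]
  exact ⟨fun n hn => monicSum_eq_zero hm hψ hG (polyChar_zero P) hG0 (by omega),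
    fun n hn => monicSum_functional_equation hm hψ hG hF hχ hdeg hGe.symm hG0 hn⟩

end Coefficients

/-! ### Absolute convergence and summation by degree -/

section Analytic

variable {F : Type*} [Field F] [Fintype F]

theorem abs_chi_le_one (hF : ringChar F ≠ 2) (D : F[X]) {f : F[X]} (hf : f.Monic) :
    |chi D f| ≤ 1 := by
  classical
  rw [chi_eq_resultant hF D hf]
  rcases quadraticChar_isQuadratic F (resultant f D) with h | h | h <;> rw [h] <;> simp

theorem polyNorm_cpow (f : F[X]) (s : ℂ) :
    (polyNorm f : ℂ) ^ s = (((Fintype.card F : ℂ) ^ (-s)) ^ f.natDegree)⁻¹ := by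
  rw [polyNorm, Complex.cpow_neg, inv_pow, inv_inv]
  induction f.natDegree with
  | zero => simp
  | succ n ih => rw [pow_succ, pow_succ, Nat.cast_mul, Complex.natCast_mul_natCast_cpow, ih]

theorem div_polyNorm_cpow (z : ℂ) (f : F[X]) (s : ℂ) :
    z / (polyNorm f : ℂ) ^ s = z * ((Fintype.card F : ℂ) ^ (-s)) ^ f.natDegree := by
  rw [polyNorm_cpow, div_inv_eq_mul]

theorem sum_monicDegLT {M : Type*} [AddCommMonoid M] (n : ℕ) (h : F[X] → M) :
    ∑ f ∈ monicDegLT F n, h f = ∑ m ∈ Finset.range n, ∑ f ∈ monicDegEq F m, h f := by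
  classical
  rw [← Finset.sum_fiberwise_of_maps_to (s := monicDegLT F n) (t := Finset.range n)
    (g := natDegree) (fun f hf => Finset.mem_range.mpr ((mem_monicDegLT F).mp hf).2)]
  refine Finset.sum_congr rfl fun m hm => Finset.sum_congr ?_ fun _ _ => rfl
  ext f
  rw [Finset.mem_filter, mem_monicDegLT, mem_monicDegEq]
  have := Finset.mem_range.mp hm
  constructor
  · rintro ⟨⟨h1, _⟩, h2⟩
    exact ⟨h1, h2⟩
  · rintro ⟨h1, h2⟩
    exact ⟨⟨h1, by omega⟩, h2⟩

theorem sum_monicDegLT_chi (D : F[X]) (n : ℕ) (s : ℂ) :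
    ∑ f ∈ monicDegLT F n, (chi D f : ℂ) / (polyNorm f : ℂ) ^ s =
      ∑ m ∈ Finset.range n, (lCoeff D m : ℂ) * ((Fintype.card F : ℂ) ^ (-s)) ^ m := by
  rw [sum_monicDegLT]
  refine Finset.sum_congr rfl fun m _ => ?_
  rw [lCoeff, Int.cast_sum, Finset.sum_mul]
  refine Finset.sum_congr rfl fun f hf => ?_
  rw [div_polyNorm_cpow, ((mem_monicDegEq F).mp hf).2]

/-- The monic polynomials of degree `n`, as a fibre of the degree map on monic polynomials. -/
noncomputable def monicFiberEquiv (n : ℕ) :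
    monicDegEq F n ≃ (fun f : {f : F[X] // f.Monic} => f.1.natDegree) ⁻¹' {n} where
  toFun f := ⟨⟨f.1, ((mem_monicDegEq F).mp f.2).1⟩, ((mem_monicDegEq F).mp f.2).2⟩
  invFun f := ⟨f.1.1, (mem_monicDegEq F).mpr ⟨f.1.2, f.2⟩⟩
  left_inv _ := rfl
  right_inv _ := rfl

theorem hasSum_monicFiber {M : Type*} [AddCommMonoid M] [TopologicalSpace M] (n : ℕ)
    (h : F[X] → M) :
    HasSum (fun f : (fun f : {f : F[X] // f.Monic} => f.1.natDegree) ⁻¹' {n} => h f.1.1)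
      (∑ f ∈ monicDegEq F n, h f) := by
  rw [← (monicFiberEquiv n).hasSum_iff, ← Finset.sum_coe_sort]
  exact hasSum_fintype _

/-- The `q^n` monic polynomials of degree `n` contribute `(qr)^n` in total, leaving a geometric
series. -/
theorem summable_monic {r : ℝ} (h0 : 0 ≤ r) (h1 : Fintype.card F * r < 1) :
    Summable fun f : {f : F[X] // f.Monic} => r ^ f.1.natDegree := by
  rw [summable_partition (s := fun n => (fun f : {f : F[X] // f.Monic} => f.1.natDegree) ⁻¹' {n})
    (fun f => by positivity) (fun f => ⟨f.1.natDegree, rfl, fun _ h => h.symm⟩)]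
  refine ⟨fun n => (hasSum_monicFiber n fun f => r ^ f.natDegree).summable, ?_⟩
  simp_rw [fun n => (hasSum_monicFiber n fun f : F[X] => r ^ f.natDegree).tsum_eq]
  refine (summable_geometric_of_lt_one (by positivity) h1).congr fun n => ?_
  rw [Finset.sum_congr rfl (g := fun _ => r ^ n) fun f hf => by rw [((mem_monicDegEq F).mp hf).2],
    Finset.sum_const, card_monicDegEq, nsmul_eq_mul, mul_pow, Nat.cast_pow]

theorem hasSum_LFunction (hF : ringChar F ≠ 2) (D : F[X]) {s : ℂ} (hs : 1 < s.re) :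
    HasSum (fun f : {f : F[X] // f.Monic} => (chi D f.1 : ℂ) / (polyNorm f.1 : ℂ) ^ s)
      (LFunction D s) := by
  have hq : (1 : ℝ) < Fintype.card F := Nat.one_lt_cast.mpr Fintype.one_lt_card
  set u := (Fintype.card F : ℂ) ^ (-s) with hu
  -- The left side is `q^(1 - Re s)`.
  have hun : Fintype.card F * ‖u‖ < 1 := by
    rw [hu, Complex.norm_natCast_cpow_of_pos Fintype.card_pos, Complex.neg_re]
    conv_lhs => rw [← Real.rpow_one_add' (by positivity) (by linarith)]
    exact Real.rpow_lt_one_of_one_lt_of_neg hq (by linarith)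
  have hsum : Summable fun f : {f : F[X] // f.Monic} =>
      (chi D f.1 : ℂ) / (polyNorm f.1 : ℂ) ^ s := by
    refine Summable.of_norm_bounded (summable_monic (norm_nonneg u) hun) fun f => ?_
    rw [div_polyNorm_cpow, norm_mul, norm_pow, Complex.norm_intCast]
    refine mul_le_of_le_one_left (by positivity) ?_
    exact_mod_cast abs_chi_le_one hF D f.2
  have h := hsum.hasSum.tsum_fiberwise fun f => f.1.natDegree
  simp_rw [fun n => (hasSum_monicFiber n fun f : F[X] =>
    (chi D f : ℂ) / (polyNorm f : ℂ) ^ s).tsum_eq] at h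
  have hL : LFunction D s = ∑' f : {f : F[X] // f.Monic}, (chi D f.1 : ℂ) / (polyNorm f.1 : ℂ) ^ s := by
    rw [← h.tsum_eq, LFunction]
    refine tsum_congr fun n => ?_
    rw [lCoeff, Int.cast_sum, Finset.sum_mul]
    refine Finset.sum_congr rfl fun f hf => ?_
    rw [div_polyNorm_cpow, ((mem_monicDegEq F).mp hf).2]
  rw [hL]
  exact hsum.hasSum

end Analytic

/-- The approximate functional equation for a polynomial of degree at most `2 * g` whose
coefficients satisfy `q ^ g * a n = q ^ n * a (2 * g - n)`. -/
theorem sum_range_eq_of_functional_equation {q u : ℂ} (hq : q ≠ 0) (hu : u ≠ 0) {a : ℕ → ℂ} {g : ℕ}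
    (ha : ∀ n ≤ 2 * g, q ^ g * a n = q ^ n * a (2 * g - n)) :
    ∑ n ∈ Finset.range (2 * g + 1), a n * u ^ n =
      ∑ n ∈ Finset.range (g + 1), a n * u ^ n +
        (q * u ^ 2) ^ g * ∑ n ∈ Finset.range g, a n * ((q * u)⁻¹) ^ n := by
  -- The upper half is listed backwards, so that index `m < g` carries degree `2g - m` and pairs
  -- with `a m`.
  rw [show 2 * g + 1 = (g + 1) + g by ring, Finset.sum_range_add,
    ← Finset.sum_range_reflect (fun x => a (g + 1 + x) * u ^ (g + 1 + x)), Finset.mul_sum]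
  congr 1
  refine Finset.sum_congr rfl fun m hm => ?_
  have hm := Finset.mem_range.mp hm
  have h := ha m (by omega)
  rw [show g + 1 + (g - 1 - m) = 2 * g - m by omega]
  have hu' : u ^ (2 * g) = u ^ (2 * g - m) * u ^ m := by rw [← pow_add]; congr 1; omega
  rw [inv_pow, mul_pow, mul_pow, ← pow_mul, hu']
  field_simp
  linear_combination (-1 : ℂ) * h

end QuadL

theorem mainTheorem5 {F : Type*} [Field F] [Fintype F] (hq : Fintype.card F % 4 = 1)
    (g : ℕ) (D : F[X]) (hD : D ∈ QuadL.monicSquarefree F (2 * g + 1)) :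
    (∀ s : ℂ, 1 < s.re →
      HasSum (fun f : {f : F[X] // f.Monic} =>
        (QuadL.chi D f.1 : ℂ) / (QuadL.polyNorm f.1 : ℂ) ^ s) (QuadL.LFunction D s)) ∧
    (∀ n : ℕ, 2 * g < n → QuadL.lCoeff D n = 0) ∧
    (∀ s : ℂ, QuadL.LFunction D s =
      (∑ f ∈ QuadL.monicDegLE F g,
        (QuadL.chi D f : ℂ) / (QuadL.polyNorm f : ℂ) ^ s) +
      ((Fintype.card F : ℂ) ^ (1 - 2 * s)) ^ g *
        ∑ f ∈ QuadL.monicDegLT F g,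
          (QuadL.chi D f : ℂ) / (QuadL.polyNorm f : ℂ) ^ (1 - s)) := by
  obtain ⟨hzero, hfe⟩ := QuadL.lCoeff_functional_equation hq hD
  refine ⟨fun s hs => QuadL.hasSum_LFunction (QuadL.ringChar_ne_two_of_card_mod_four hq) D hs,
    hzero, fun s => ?_⟩
  have hq0 : (Fintype.card F : ℂ) ≠ 0 := Nat.cast_ne_zero.mpr Fintype.card_ne_zero
  -- With `u = q^(-s)`, the factor is `q u²`, and replacing `s` by `1 - s` turns `u` into `(q u)⁻¹`.
  have h1 : (Fintype.card F : ℂ) ^ (1 - 2 * s) =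
      Fintype.card F * ((Fintype.card F : ℂ) ^ (-s)) ^ 2 := by
    rw [← Complex.cpow_nat_mul, Nat.cast_ofNat, show 1 - 2 * s = 1 + 2 * -s by ring,
      Complex.cpow_add _ _ hq0, Complex.cpow_one]
  have h2 : (Fintype.card F : ℂ) ^ (-(1 - s)) =
      (Fintype.card F * (Fintype.card F : ℂ) ^ (-s))⁻¹ := by
    rw [Complex.cpow_neg, sub_eq_add_neg, Complex.cpow_add _ _ hq0, Complex.cpow_one]
  have h3 : (Fintype.card F : ℂ) ^ (-s) ≠ 0 := by
    rw [Complex.cpow_def_of_ne_zero hq0]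
    exact Complex.exp_ne_zero _
  rw [QuadL.monicDegLE, QuadL.sum_monicDegLT_chi, QuadL.sum_monicDegLT_chi, h1, h2,
    ← QuadL.sum_range_eq_of_functional_equation hq0
      h3
      (fun n hn => by exact_mod_cast hfe n hn), QuadL.LFunction,
    tsum_eq_sum (s := Finset.range (2 * g + 1))]
  intro n hn
  rw [hzero n (by simpa using hn), Int.cast_zero, zero_mul]
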